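/- Let $d\ge 1$, $\alpha\ge 0$, and let $\varphi:\mathbb R^d\to\mathbb R$ be bounded, radially symmetric and radially non-increasing (possibly not compactly supported), with $B_3(0)\subset\operatorname{supp}\varphi$. Let $\psi:\mathbb R^d\to\mathbb R$ be a Borel function equivalent to $\varphi$, i.e. for some constant $C>0$ one has $\varphi(x)\le C\psi(x)$ and $\psi(x)\le C\varphi(x)$ for all $x\in\mathbb R^d$. Let $\mu$ be a real-valued signed Borel measure of bounded variation on $\mathbb R^d$, and let $g:[0,\infty)\to[0,\infty)$ be regular, i.e. $g$ is continuous, non-decreasing, $g(0)=0$, and for some $c>1$ and some constant $C$ one has $g(x)\le C g(cx)$ and $g(cx)\le C g(x)$ for all $x\ge 0$. Assume that there is a constant $C$ such that $$\sum_{B_{r}(x)\in\mathfrak B}\Big|\int_{\mathbb R^d}\psi\Big(\frac{y-x}{r}\Big)\,d\mu(y)\Big|\le C\, g\Big(\sum_{B_{r}(x)\in\mathfrak B} r^\alpha\Big)$$ for every family $\mathfrak B$ of pairwise disjoint open balls in $\mathbb R^d$ with $\sum_{B_r(x)\in\mathfrak B} r^\alpha<\infty$. Let $\mathcal H^\alpha$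 be the $\alpha$-dimensional Hausdorff measure on $\mathbb R^d$ and $|\mu|$ the total variation of $\mu$. 1. If $|\varphi(x)|=O(|x|^{-\alpha})$ as $|x|\to\infty$, then $\mu$ is absolutely continuous with respect to $\mathcal H^\alpha$, i.e. $|\mu|(A)=0$ whenever $\mathcal H^\alpha(A)=0$. 2. If $|\varphi(x)|=o(|x|^{-\alpha})$ as $|x|\to\infty$, then there is a constant $C$ such that $|\mu|(A)\le C\,g(\mathcal H^\alpha(A))$ for every Borel set $A\subset\mathbb R^d$ with $\mathcal H^\alpha(A)<\infty$. -/

import Mathlib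

open MeasureTheory Filter Set Asymptotics
open scoped NNReal ENNReal

/-- `φ` is radially symmetric and radially non-increasing. -/
def RadiallyNonincreasing {d : ℕ} (φ : EuclideanSpace ℝ (Fin d) → ℝ) : Prop :=
  ∃ θ : ℝ → ℝ, AntitoneOn θ (Set.Ici 0) ∧ ∀ x, φ x = θ ‖x‖

/-- `φ ≍ ψ`: each function is bounded by a positive constant times the other one, pointwise. -/
def EquivalentFunctions {X : Type*} (φ ψ : X → ℝ) : Prop :=
  ∃ C : ℝ, 0 < C ∧ ∀ x, φ x ≤ C * ψ x ∧ ψ x ≤ C * φ x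

/-- A regular function `g : [0, ∞) → [0, ∞)`: continuous, vanishing at `0`, non-decreasing, and
such that `g x ≍ g (c x)` for some fixed `c > 1`. -/
structure IsRegularFunction (g : ℝ≥0 → ℝ≥0) : Prop where
  continuous : Continuous g
  map_zero : g 0 = 0
  monotone : Monotone g
  doubling : ∃ c : ℝ≥0, 1 < c ∧ ∃ C : ℝ≥0, ∀ x, g x ≤ C * g (c * x) ∧ g (c * x) ≤ C * g x

/-- A disjoint family of open balls in `ℝᵈ`. The pair `(x, r)` stands for the ball of center `x`
and radius `r > 0`. -/
def IsDisjointBallFamily {d : ℕ} (𝔅 : Set (EuclideanSpace ℝ (Fin d) × ℝ)) : Prop :=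
  (∀ B ∈ 𝔅, 0 < B.2) ∧ 𝔅.PairwiseDisjoint (fun B => Metric.ball B.1 B.2)

/-- `∫ ψ ((y - x) / r) dμ(y)`, the `ψ`-smoothing of the value of `μ` on the ball `B = (x, r)`. -/
noncomputable def smoothedValue {d : ℕ} (μ : SignedMeasure (EuclideanSpace ℝ (Fin d)))
    (ψ : EuclideanSpace ℝ (Fin d) → ℝ) (B : EuclideanSpace ℝ (Fin d) × ℝ) : ℝ :=
  VectorMeasure.integral μ (fun y => ψ (B.2⁻¹ • (y - B.1))) (ContinuousLinearMap.lsmul ℝ ℝ).flip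

/-- The disjoint-ball estimate: for some constant `C` and every disjoint family of balls `𝔅` with
`∑ r ^ α < ∞`, one has `∑ |∫ ψ ((y - x) / r) dμ(y)| ≤ C g (∑ r ^ α)`. -/
def DisjointBallEstimate {d : ℕ} (μ : SignedMeasure (EuclideanSpace ℝ (Fin d)))
    (ψ : EuclideanSpace ℝ (Fin d) → ℝ) (g : ℝ≥0 → ℝ≥0) (α : ℝ) : Prop :=
  ∃ C : ℝ≥0, ∀ 𝔅 : Set (EuclideanSpace ℝ (Fin d) × ℝ), IsDisjointBallFamily 𝔅 →
    (∑' B : 𝔅, ENNReal.ofReal (B.1.2 ^ α)) ≠ ∞ →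
    (∑' B : 𝔅, ENNReal.ofReal |smoothedValue μ ψ B.1|) ≤
      ((C * g (∑' B : 𝔅, ENNReal.ofReal (B.1.2 ^ α)).toNNReal : ℝ≥0) : ℝ≥0∞)

/-! Write `μ = p - n` by Jordan decomposition. At `p`-almost every `x`, differentiation of measures
makes `n` much smaller than `p` on all small balls around `x`. By the layer-cake formula this passes
to integrals of radially non-increasing kernels, so there is little cancellation: the smoothing of
`μ` at `x` controls the `p`-mass of the ball of radius `23/8 * r`, up to the kernel's tail beyond a
fixed distance `s₀`, which is at most a multiple of `τ * s₀ ^ (-α) * r ^ α`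
(`measureReal_closedBall_le_of_smoothing`).

A Vitali covering by such balls with `∑ r ^ α ≤ T`, for any `T` above `4 ^ α * H(A)`, where `H` is
the Hausdorff measure, gives `p A ≤ C * (g T + τ * s₀ ^ (-α) * T)` with `C` independent of `s₀`, on
sets where `s₀` is uniform. For null sets let `T → 0`. In the little-o case let `τ → 0` first, then
`T → 4 ^ α * H(A)`, and absorb `4 ^ α` by doubling of `g`. Exhaustion in `s₀` and exchanging `p` and
`n` conclude. -/

open Metric Topology

/-! ### Comparison of the Jordan parts on small balls -/

/-- The integral against a signed measure of a bounded measurable function is the difference of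
the integrals against the parts of the Jordan decomposition. -/
theorem smoothedValue_eq_sub {d : ℕ} (μ : SignedMeasure (EuclideanSpace ℝ (Fin d)))
    {ψ : EuclideanSpace ℝ (Fin d) → ℝ} (hψ : Measurable ψ) {M : ℝ} (hM : ∀ x, |ψ x| ≤ M)
    (B : EuclideanSpace ℝ (Fin d) × ℝ) :
    smoothedValue μ ψ B =
      ∫ y, ψ (B.2⁻¹ • (y - B.1)) ∂μ.toJordanDecomposition.posPart -
      ∫ y, ψ (B.2⁻¹ • (y - B.1)) ∂μ.toJordanDecomposition.negPart := by
  have hm : Measurable fun y => ψ (B.2⁻¹ • (y - B.1)) := hψ.comp (by fun_prop)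
  have hint (ν : Measure (EuclideanSpace ℝ (Fin d))) [IsFiniteMeasure ν] :
      Integrable (fun y => ψ (B.2⁻¹ • (y - B.1))) ν :=
    Integrable.of_bound hm.aestronglyMeasurable M (Eventually.of_forall fun y => hM _)
  rw [smoothedValue]
  conv_lhs => rw [← μ.toSignedMeasure_toJordanDecomposition, JordanDecomposition.toSignedMeasure]
  rw [VectorMeasure.integral_sub_vectorMeasure, VectorMeasure.integral_toSignedMeasure,
    VectorMeasure.integral_toSignedMeasure]
  · rw [VectorMeasure.Integrable, Measure.variation_toSignedMeasure]; exact hint _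
  · rw [VectorMeasure.Integrable, Measure.variation_toSignedMeasure]; exact hint _

/-- If two measures are mutually singular, then at almost every point for the first one, the
second one is negligible on small balls. -/
theorem ae_exists_measure_closedBall_le {E : Type*} [NormedAddCommGroup E] [NormedSpace ℝ E]
    [FiniteDimensional ℝ E] [MeasurableSpace E] [BorelSpace E] (p n : Measure E)
    [IsFiniteMeasure p] [IsFiniteMeasure n] (hpn : p ⟂ₘ n) {ε : ℝ≥0∞} (hε : ε ≠ 0) (hε' : ε ≠ ∞) :
    ∀ᵐ x ∂p, ∃ k : ℕ, ∀ s, 0 ≤ s → s ≤ 1 / ((k : ℝ) + 1) →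
      n (closedBall x s) ≤ ε * p (closedBall x s) := by
  -- Differentiation only sees positive radii; this covers the radius `0`.
  have h0 : ∀ᵐ x ∂p, n {x} = 0 := by
    have : ∀ᵐ x ∂p, x ∉ hpn.nullSet := by
      rw [ae_iff]; simp
    filter_upwards [this] with x hx
    exact measure_mono_null (by simpa using hx) hpn.measure_compl_nullSet
  filter_upwards [h0, Besicovitch.ae_tendsto_rnDeriv n p,
    Measure.rnDeriv_eq_zero_of_mutuallySingular hpn.symm Measure.AbsolutelyContinuous.rfl]
    with x hx ht hz
  rw [hz] at ht
  have hev := ht.eventually (gt_mem_nhds (pos_iff_ne_zero.2 hε))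
  obtain ⟨s₀, hs₀, hs⟩ := mem_nhdsGT_iff_exists_Ioo_subset.1 hev
  obtain ⟨k, hk⟩ := exists_nat_one_div_lt (show (0 : ℝ) < s₀ from hs₀)
  refine ⟨k, fun s hs0 hsk => ?_⟩
  rcases hs0.eq_or_lt with rfl | hs0
  · simp [hx]
  · have := hs ⟨hs0, hsk.trans_lt hk⟩
    exact (ENNReal.div_le_iff_le_mul (Or.inr hε') (Or.inr hε)).1 (le_of_lt this)

/-- A comparison of two measures on balls centered at `x` extends to integrals of radially
non-increasing functions. -/
theorem setLIntegral_closedBall_le_of_antitone {E : Type*} [PseudoMetricSpace E] [MeasurableSpace E]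
    [BorelSpace E] {p n : Measure E} {x : E} {s₀ : ℝ} {ε : ℝ≥0∞} (hε : ε ≠ ∞)
    (h : ∀ s, 0 ≤ s → s ≤ s₀ → n (closedBall x s) ≤ ε * p (closedBall x s))
    {f : ℝ → ℝ} (hf : Antitone f) (hf0 : ∀ t, 0 ≤ f t) :
    ∫⁻ y in closedBall x s₀, ENNReal.ofReal (f (dist y x)) ∂n ≤
      ε * ∫⁻ y in closedBall x s₀, ENNReal.ofReal (f (dist y x)) ∂p := by
  have hm : Measurable fun y => f (dist y x) := hf.measurable.comp (by fun_prop)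
  rw [lintegral_eq_lintegral_meas_le _ (Eventually.of_forall fun y => hf0 _) hm.aemeasurable,
    lintegral_eq_lintegral_meas_le _ (Eventually.of_forall fun y => hf0 _) hm.aemeasurable,
    ← lintegral_const_mul' _ _ hε]
  refine lintegral_mono fun t => ?_
  have hS : MeasurableSet {a | t ≤ f (dist a x)} := measurableSet_le measurable_const hm
  change n.restrict _ {a | t ≤ f (dist a x)} ≤ ε * p.restrict _ {a | t ≤ f (dist a x)}
  rw [Measure.restrict_apply hS, Measure.restrict_apply hS]
  -- Superlevel sets of the kernel are balls around `x`: closed if `sSup I` is attained, otherwise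
  -- open and hence an increasing union of closed balls.
  set I : Set ℝ := {u | 0 ≤ u ∧ u ≤ s₀ ∧ t ≤ f u} with hI
  have hSI : {a | t ≤ f (dist a x)} ∩ closedBall x s₀ = {a | dist a x ∈ I} := by
    ext a; simp [hI, dist_nonneg, and_comm]
  rw [hSI]
  rcases I.eq_empty_or_nonempty with hE | hne
  · simp [hE]
  have hbdd : BddAbove I := ⟨s₀, fun u hu => hu.2.1⟩
  set b := sSup I
  have hb0 : 0 ≤ b := by obtain ⟨u, hu⟩ := hne; exact hu.1.trans (le_csSup hbdd hu)
  have hbs : b ≤ s₀ := csSup_le hne fun u hu => hu.2.1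
  by_cases hbI : b ∈ I
  · have : {a | dist a x ∈ I} = closedBall x b := by
      ext a
      refine ⟨fun ha => le_csSup hbdd ha, fun ha => ⟨dist_nonneg, ?_, hbI.2.2.trans (hf ha)⟩⟩
      exact le_trans ha hbs
    rw [this]; exact h b hb0 hbs
  · have hball : {a | dist a x ∈ I} = ball x b := by
      ext a
      refine ⟨fun ha => lt_of_le_of_ne (le_csSup hbdd ha) fun hab => hbI ?_, fun ha => ?_⟩
      · rw [show b = dist a x from hab.symm]; exact ha
      obtain ⟨u, hu, hau⟩ := exists_lt_of_lt_csSup hne (show dist a x < b from ha)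
      exact ⟨dist_nonneg, hau.le.trans hu.2.1, hu.2.2.trans (hf hau.le)⟩
    rw [hball]
    have hbpos : 0 < b := by
      refine hb0.lt_of_ne fun h0 => hbI ?_
      obtain ⟨u, hu⟩ := hne
      have : u = b := le_antisymm (le_csSup hbdd hu) (h0 ▸ hu.1)
      exact this ▸ hu
    obtain ⟨v, hvmono, hvlt, hvlim⟩ := exists_seq_strictMono_tendsto' hbpos
    have hU : ball x b = ⋃ i, closedBall x (v i) := by
      ext a
      simp only [mem_ball, mem_iUnion, mem_closedBall]
      refine ⟨fun ha => ?_, fun ⟨i, hi⟩ => hi.trans_lt (hvlt i).2⟩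
      obtain ⟨i, hi⟩ := (hvlim.eventually (lt_mem_nhds ha)).exists
      exact ⟨i, hi.le⟩
    have hmono : Monotone fun i => closedBall x (v i) :=
      fun i j hij => closedBall_subset_closedBall (hvmono.monotone hij)
    rw [hU, hmono.measure_iUnion, hmono.measure_iUnion, ENNReal.mul_iSup]
    exact iSup_mono fun i => h _ (hvlt i).1.le ((hvlt i).2.le.trans hbs)

/-- If `n` is much smaller than `p` on small balls centered at `x`, and the tail of the rescaled
radial kernel is small, then the smoothing of `p - n` controls the mass that `p` gives to a ball. -/
theorem measureReal_closedBall_le_of_smoothing {E : Type*} [NormedAddCommGroup E] [NormedSpace ℝ E]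
    [MeasurableSpace E] [BorelSpace E] {p n : Measure E} [IsFiniteMeasure p] [IsFiniteMeasure n]
    {θ : ℝ → ℝ} (hθ : Antitone θ) (hθ0 : ∀ t, 0 ≤ θ t) {ψ : E → ℝ} (hψ : Measurable ψ) {K : ℝ}
    (hK : 0 < K) (hθψ : ∀ x, θ ‖x‖ ≤ K * ψ x) (hψθ : ∀ x, ψ x ≤ K * θ ‖x‖)
    {x : E} {r s₀ ρ τ : ℝ} (hr : 0 < r)
    (h : ∀ s, 0 ≤ s → s ≤ s₀ →
      n (closedBall x s) ≤ ENNReal.ofReal (1 / (2 * K ^ 2)) * p (closedBall x s))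
    (hτ : ∀ y, s₀ < dist y x → θ ‖r⁻¹ • (y - x)‖ ≤ τ) (hτ0 : 0 ≤ τ) :
    θ ρ * p.real (closedBall x (ρ * r)) ≤
      2 * K * |∫ y, ψ (r⁻¹ • (y - x)) ∂p - ∫ y, ψ (r⁻¹ • (y - x)) ∂n| +
        2 * K ^ 2 * (τ * n.real univ) := by
  have hnorm : ∀ y, ‖r⁻¹ • (y - x)‖ = r⁻¹ * dist y x := fun y => by
    rw [norm_smul, dist_eq_norm, Real.norm_of_nonneg (inv_pos.2 hr).le]
  set f : ℝ → ℝ := fun t => θ (r⁻¹ * t) with hf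
  have hfa : Antitone f := fun a b hab => hθ (mul_le_mul_of_nonneg_left hab (inv_pos.2 hr).le)
  have hf0 : ∀ t, 0 ≤ f t := fun t => hθ0 _
  have hfθ : ∀ y, θ ‖r⁻¹ • (y - x)‖ = f (dist y x) := fun y => by rw [hnorm]
  have hfm : Measurable fun y => f (dist y x) := hfa.measurable.comp (by fun_prop)
  have hfi (ν : Measure E) [IsFiniteMeasure ν] : Integrable (fun y => f (dist y x)) ν :=
    Integrable.of_bound hfm.aestronglyMeasurable (f 0) (Eventually.of_forall fun y => by
      rw [Real.norm_of_nonneg (hf0 _)]; exact hfa dist_nonneg)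
  have hψ0 : ∀ z, 0 ≤ ψ z := fun z =>
    nonneg_of_mul_nonneg_right ((hθ0 _).trans (hθψ z)) hK
  have hψi (ν : Measure E) [IsFiniteMeasure ν] : Integrable (fun y => ψ (r⁻¹ • (y - x))) ν := by
    refine ((hfi ν).const_mul K).mono' (hψ.comp (by fun_prop)).aestronglyMeasurable
      (Eventually.of_forall fun y => ?_)
    rw [Real.norm_of_nonneg (hψ0 _), ← hfθ]; exact hψθ _
  have h1 : ∫ y, f (dist y x) ∂p ≤ K * ∫ y, ψ (r⁻¹ • (y - x)) ∂p := by
    rw [← integral_const_mul]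
    exact integral_mono (hfi p) ((hψi p).const_mul K) fun y => by
      simp only [← hfθ]; exact hθψ _
  have h2 : ∫ y, ψ (r⁻¹ • (y - x)) ∂n ≤ K * ∫ y, f (dist y x) ∂n := by
    rw [← integral_const_mul]
    exact integral_mono (hψi n) ((hfi n).const_mul K) fun y => by
      simp only [← hfθ]; exact hψθ _
  have h3 : ∫ y in closedBall x s₀, f (dist y x) ∂n ≤ 1 / (2 * K ^ 2) * ∫ y, f (dist y x) ∂p := by
    refine le_trans ?_ (mul_le_mul_of_nonneg_left (setIntegral_le_integral (s := closedBall x s₀)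
      (hfi p) (Eventually.of_forall fun y => hf0 _)) (by positivity))
    have := setLIntegral_closedBall_le_of_antitone ENNReal.ofReal_ne_top h hfa hf0
    rw [← ofReal_integral_eq_lintegral_ofReal (hfi n).integrableOn
        (Eventually.of_forall fun y => hf0 _),
      ← ofReal_integral_eq_lintegral_ofReal (hfi p).integrableOn
        (Eventually.of_forall fun y => hf0 _),
      ← ENNReal.ofReal_mul (by positivity)] at this
    exact (ENNReal.ofReal_le_ofReal_iff (mul_nonneg (by positivity)
      (integral_nonneg fun y => hf0 _))).1 this
  have h4 : ∫ y in (closedBall x s₀)ᶜ, f (dist y x) ∂n ≤ τ * n.real univ := by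
    calc ∫ y in (closedBall x s₀)ᶜ, f (dist y x) ∂n
        ≤ ∫ y in (closedBall x s₀)ᶜ, τ ∂n := by
          refine setIntegral_mono_on (hfi n).integrableOn (integrable_const τ).integrableOn
            measurableSet_closedBall.compl fun y hy => ?_
          rw [← hfθ]; exact hτ y (by simpa using hy)
      _ ≤ ∫ y, τ ∂n := setIntegral_le_integral (integrable_const τ)
          (Eventually.of_forall fun _ => hτ0)
      _ = τ * n.real univ := by simp [mul_comm]
  have h5 : θ ρ * p.real (closedBall x (ρ * r)) ≤ ∫ y, f (dist y x) ∂p := by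
    calc θ ρ * p.real (closedBall x (ρ * r))
        = ∫ y in closedBall x (ρ * r), θ ρ ∂p := by simp [mul_comm]
      _ ≤ ∫ y in closedBall x (ρ * r), f (dist y x) ∂p := by
          refine setIntegral_mono_on (integrable_const _).integrableOn (hfi p).integrableOn
            measurableSet_closedBall fun y hy => hθ ?_
          rw [inv_mul_le_iff₀ hr, mul_comm]; exact hy
      _ ≤ _ := setIntegral_le_integral (hfi p) (Eventually.of_forall fun y => hf0 _)
  have h6 := integral_add_compl (μ := n) (measurableSet_closedBall (x := x) (ε := s₀)) (hfi n)
  have h7 := le_abs_self (∫ y, ψ (r⁻¹ • (y - x)) ∂p - ∫ y, ψ (r⁻¹ • (y - x)) ∂n)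
  set a := ∫ y, f (dist y x) ∂p
  set b := ∫ y, f (dist y x) ∂n
  set D := |∫ y, ψ (r⁻¹ • (y - x)) ∂p - ∫ y, ψ (r⁻¹ • (y - x)) ∂n|
  have h8 : K * ∫ y, ψ (r⁻¹ • (y - x)) ∂p ≤ K * (D + K * b) :=
    mul_le_mul_of_nonneg_left (by linarith) hK.le
  have h9 : K ^ 2 * b ≤ K ^ 2 * (1 / (2 * K ^ 2) * a + τ * n.real univ) :=
    mul_le_mul_of_nonneg_left (by linarith) (by positivity)
  -- Passing between `ψ` and `θ` costs `K` twice; the choice `1 / (2 * K ^ 2)` leaves `a / 2`,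
  -- absorbed on the left.
  have h10 : K ^ 2 * (1 / (2 * K ^ 2) * a) = a / 2 := by field_simp
  nlinarith

/-! ### Covering by disjoint balls -/

/-- A set of finite Hausdorff measure can be covered by enlargements of disjoint small balls
centered on it, with control on the sum of the powers of the radii. -/
theorem exists_disjointBallFamily_cover {d : ℕ} {α : ℝ} (hα : 0 ≤ α)
    (A : Set (EuclideanSpace ℝ (Fin d))) {T : ℝ≥0∞}
    (hT : ENNReal.ofReal (4 ^ α) * Measure.hausdorffMeasure α A < T) {r₀ : ℝ} (hr₀ : 0 < r₀) :
    ∃ u : Set (EuclideanSpace ℝ (Fin d) × ℝ), IsDisjointBallFamily u ∧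
      (∀ B ∈ u, B.1 ∈ A ∧ B.2 ≤ r₀) ∧ A ⊆ ⋃ B ∈ u, closedBall B.1 (23 / 8 * B.2) ∧
      ∑' B : u, ENNReal.ofReal (B.1.2 ^ α) ≤ T := by
  have h4 : (0 : ℝ) < 4 ^ α := by positivity
  obtain ⟨T', hT1, hT2⟩ := exists_between hT
  obtain ⟨η, hη, hηT⟩ : ∃ η : ℝ≥0∞, η ≠ 0 ∧ T' + η ≤ T :=
    ⟨T - T', (tsub_pos_of_lt hT2).ne', (add_tsub_cancel_of_le hT2.le).le⟩
  obtain ⟨η', hη'0, hη'⟩ := ENNReal.exists_pos_sum_of_countable hη ℕ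
  have hH : Measure.hausdorffMeasure α A < T' / ENNReal.ofReal (4 ^ α) := by
    rw [ENNReal.lt_div_iff_mul_lt (by simp [h4]) (by simp), mul_comm]; exact hT1
  rw [Measure.hausdorffMeasure_apply] at hH
  have hH' := (le_iSup₂ (f := fun (r : ℝ≥0∞) (_ : 0 < r) =>
    ⨅ (t : ℕ → Set (EuclideanSpace ℝ (Fin d))) (_ : A ⊆ ⋃ n, t n) (_ : ∀ n, ediam (t n) ≤ r),
      ∑' n, ⨆ _ : (t n).Nonempty, ediam (t n) ^ α) (ENNReal.ofReal (r₀ / 8))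
      (by simpa using hr₀)).trans_lt hH
  simp only [iInf_lt_iff] at hH'
  obtain ⟨t, hAt, htd, hts⟩ := hH'
  have htop : ∀ i, ediam (t i) ≠ ∞ := fun i => ((htd i).trans_lt ENNReal.ofReal_lt_top).ne
  have hdiam : ∀ i, diam (t i) ≤ r₀ / 8 := fun i =>
    ENNReal.toReal_le_of_le_ofReal (by positivity) (htd i)
  -- The radius strictly exceeds `4 * diam (t i)`, since the diameter may vanish; `η' i` pays for
  -- the excess.
  have hrad : ∀ i, ∃ r, 4 * diam (t i) ≤ r ∧ 0 < r ∧ r ≤ r₀ ∧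
      r ^ α ≤ (4 * diam (t i)) ^ α + η' i := by
    intro i
    have hc : ContinuousAt (fun v : ℝ => v ^ α) (4 * diam (t i)) :=
      (Real.continuous_rpow_const hα).continuousAt
    have h1 : ∀ᶠ v in 𝓝[>] (4 * diam (t i)), v ^ α < (4 * diam (t i)) ^ α + η' i :=
      (hc.eventually (gt_mem_nhds (by simpa using hη'0 i))).filter_mono nhdsWithin_le_nhds
    have h2 : ∀ᶠ v in 𝓝[>] (4 * diam (t i)), v < r₀ :=
      (gt_mem_nhds (by linarith [hdiam i])).filter_mono nhdsWithin_le_nhds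
    obtain ⟨v, hv1, hv2, hv3⟩ := (h1.and (h2.and self_mem_nhdsWithin)).exists
    exact ⟨v, le_of_lt hv3, (by positivity : (0 : ℝ) ≤ 4 * diam (t i)).trans_lt hv3, hv2.le, hv1.le⟩
  choose r hr1 hr2 hr3 hr4 using hrad
  -- Only pieces meeting `A` are kept, so that the centers can be chosen in `A`.
  let ι := {i : ℕ // (t i ∩ A).Nonempty}
  choose x hx using fun i : ι => i.2
  let F : ι → EuclideanSpace ℝ (Fin d) × ℝ := fun i => (x i, r i)
  -- The enlargement is `(1/4 + 1) * (3/2) + 1 = 23/8`, below the radius `3` on which the kernel is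
  -- known to be positive.
  obtain ⟨u, hut, hud, hu⟩ := Vitali.exists_disjoint_subfamily_covering_enlargement
    (fun B : EuclideanSpace ℝ (Fin d) × ℝ => ball B.1 B.2) (range F) (fun B => B.2) (3 / 2)
    (by norm_num) (by rintro _ ⟨i, rfl⟩; exact (hr2 i).le) r₀ (by rintro _ ⟨i, rfl⟩; exact hr3 i)
    (by rintro _ ⟨i, rfl⟩; exact nonempty_ball.2 (hr2 i))
  refine ⟨u, ⟨fun B hB => ?_, hud⟩, fun B hB => ?_, fun y hy => ?_, ?_⟩
  · obtain ⟨i, rfl⟩ := hut hB; exact hr2 i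
  · obtain ⟨i, rfl⟩ := hut hB; exact ⟨(hx i).2, hr3 i⟩
  · obtain ⟨i, hi⟩ := mem_iUnion.1 (hAt hy)
    let j : ι := ⟨i, y, hi, hy⟩
    obtain ⟨B, hB, ⟨z, hz1, hz2⟩, hle⟩ := hu (F j) ⟨j, rfl⟩
    refine mem_iUnion₂.2 ⟨B, hB, ?_⟩
    have e1 : dist y (x j) ≤ diam (t i) := dist_le_diam_of_mem' (htop i) hi (hx j).1
    have e2 : dist z (x j) < r i := hz1
    have e3 : dist z B.1 < B.2 := hz2
    have e4 : r i ≤ 3 / 2 * B.2 := hle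
    have e5 := hr1 i
    have e6 := dist_triangle4 y (x j) z B.1
    rw [dist_comm (x j) z] at e6
    rw [mem_closedBall]
    linarith
  · calc ∑' B : u, ENNReal.ofReal (B.1.2 ^ α)
        ≤ ∑' B : range F, ENNReal.ofReal (B.1.2 ^ α) :=
          ENNReal.tsum_mono_subtype (fun B => ENNReal.ofReal (B.2 ^ α)) hut
      _ ≤ ∑' i : ι, ENNReal.ofReal (r i ^ α) :=
          ENNReal.tsum_le_tsum_comp_of_surjective (f := rangeFactorization F)
            rangeFactorization_surjective (fun B => ENNReal.ofReal (B.1.2 ^ α))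
      _ ≤ ∑' i : ι, (ENNReal.ofReal (4 ^ α) * (⨆ _ : (t i).Nonempty, ediam (t i) ^ α) + η' i) := by
          refine ENNReal.tsum_le_tsum fun i => ?_
          rw [ciSup_pos (i.2.mono inter_subset_left)]
          refine (ENNReal.ofReal_le_ofReal (hr4 i)).trans ?_
          rw [ENNReal.ofReal_add (by positivity) (by positivity),
            Real.mul_rpow (by norm_num) diam_nonneg, ENNReal.ofReal_mul h4.le,
            ← ENNReal.ofReal_rpow_of_nonneg diam_nonneg hα, diam, ENNReal.ofReal_toReal (htop i),
            ENNReal.ofReal_coe_nnreal]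
      _ ≤ ∑' i : ℕ, (ENNReal.ofReal (4 ^ α) * (⨆ _ : (t i).Nonempty, ediam (t i) ^ α) + η' i) :=
          ENNReal.tsum_comp_le_tsum_of_injective Subtype.val_injective _
      _ = ENNReal.ofReal (4 ^ α) * (∑' i : ℕ, ⨆ _ : (t i).Nonempty, ediam (t i) ^ α) +
            ∑' i : ℕ, (η' i : ℝ≥0∞) := by
          rw [ENNReal.tsum_add, ENNReal.tsum_mul_left]
      _ ≤ T' + η := by
          gcongr
          rw [mul_comm, ← ENNReal.le_div_iff_mul_le (by simp [h4]) (by simp)]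
          exact hts.le
      _ ≤ T := hηT

/-- Iterate the doubling bound until `c ^ m` exceeds `q`. -/
theorem IsRegularFunction.exists_map_mul_le {g : ℝ≥0 → ℝ≥0} (hg : IsRegularFunction g) (q : ℝ≥0) :
    ∃ C : ℝ≥0, ∀ x, g (q * x) ≤ C * g x := by
  obtain ⟨c, hc, C, hC⟩ := hg.doubling
  obtain ⟨m, hm⟩ := pow_unbounded_of_one_lt q hc
  have hpow : ∀ (m : ℕ) x, g (c ^ m * x) ≤ C ^ m * g x := by
    intro m
    induction m with
    | zero => simp
    | succ m ih =>
      intro x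
      calc g (c ^ (m + 1) * x) = g (c * (c ^ m * x)) := by ring_nf
        _ ≤ C * g (c ^ m * x) := (hC _).2
        _ ≤ C * (C ^ m * g x) := by gcongr; exact ih x
        _ = C ^ (m + 1) * g x := by ring
  exact ⟨C ^ m, fun x => (hg.monotone (by gcongr)).trans (hpow m x)⟩

/-! ### Estimates for one Jordan part -/

section

variable {d : ℕ} {α : ℝ} {θ : ℝ → ℝ} {ψ : EuclideanSpace ℝ (Fin d) → ℝ} {K : ℝ}
  {p n : Measure (EuclideanSpace ℝ (Fin d))} [IsFiniteMeasure p] [IsFiniteMeasure n]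
  {μ : SignedMeasure (EuclideanSpace ℝ (Fin d))} {g : ℝ≥0 → ℝ≥0}

/-- A bound for the measure `p` of a set at whose points `n` is uniformly much smaller than `p`,
where `p - n` satisfies the disjoint-ball estimate. -/
theorem DisjointBallEstimate.exists_measure_le (hα : 0 ≤ α) (hθ : Antitone θ) (hθ0 : ∀ t, 0 ≤ θ t)
    (hθpos : 0 < θ (23 / 8)) (hψ : Measurable ψ) (hK : 0 < K)
    (hθψ : ∀ x, θ ‖x‖ ≤ K * ψ x) (hψθ : ∀ x, ψ x ≤ K * θ ‖x‖)
    (hsm : ∀ B, |smoothedValue μ ψ B| =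
      |∫ y, ψ (B.2⁻¹ • (y - B.1)) ∂p - ∫ y, ψ (B.2⁻¹ • (y - B.1)) ∂n|)
    (hg : Monotone g) (hμ : DisjointBallEstimate μ ψ g α) :
    ∃ C : ℝ≥0, ∀ (A : Set (EuclideanSpace ℝ (Fin d))) (s₀ : ℝ), 0 < s₀ →
      (∀ x ∈ A, ∀ s, 0 ≤ s → s ≤ s₀ →
        n (closedBall x s) ≤ ENNReal.ofReal (1 / (2 * K ^ 2)) * p (closedBall x s)) →
      ∀ τ : ℝ≥0, (∃ R : ℝ, ∀ z : EuclideanSpace ℝ (Fin d), R ≤ ‖z‖ → θ ‖z‖ ≤ τ * ‖z‖ ^ (-α)) →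
      ∀ T : ℝ≥0, ENNReal.ofReal (4 ^ α) * Measure.hausdorffMeasure α A < T →
        p A ≤ ((C * (g T + τ * (s₀ ^ (-α)).toNNReal * T) : ℝ≥0) : ℝ≥0∞) := by
  obtain ⟨Cμ, hCμ⟩ := hμ
  set N := n.real univ
  set C₁ : ℝ := (2 * K + 2 * K ^ 2 * N) / θ (23 / 8) with hC₁
  have hN : 0 ≤ N := measureReal_nonneg
  have hC₁0 : 0 ≤ C₁ := by positivity
  refine ⟨C₁.toNNReal * (Cμ + 1), fun A s₀ hs₀ hA τ ⟨R, hR⟩ T hT => ?_⟩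
  have hR1 : 0 < |R| + 1 := by positivity
  -- Radii at most `s₀ / (|R| + 1)` send points farther than `s₀` from a center into the region `R ≤
  -- ‖z‖` of the decay bound.
  obtain ⟨u, hu, huA, hAu, huT⟩ := exists_disjointBallFamily_cover hα A hT (div_pos hs₀ hR1)
  have hball : ∀ B : u, p (closedBall B.1.1 (23 / 8 * B.1.2)) ≤ ENNReal.ofReal C₁ *
      (ENNReal.ofReal |smoothedValue μ ψ B.1| +
        ENNReal.ofReal (τ * s₀ ^ (-α)) * ENNReal.ofReal (B.1.2 ^ α)) := by
    rintro ⟨⟨x, r⟩, hB⟩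
    have hr : 0 < r := hu.1 _ hB
    have hrle : r ≤ s₀ / (|R| + 1) := (huA _ hB).2
    have hτ : ∀ y, s₀ < dist y x → θ ‖r⁻¹ • (y - x)‖ ≤ τ * s₀ ^ (-α) * r ^ α := by
      intro y hy
      have hz : s₀ / r ≤ ‖r⁻¹ • (y - x)‖ := by
        rw [norm_smul, Real.norm_of_nonneg (inv_pos.2 hr).le, ← dist_eq_norm, div_eq_inv_mul]
        gcongr
      have hRz : R ≤ ‖r⁻¹ • (y - x)‖ := by
        refine le_trans ?_ hz
        rw [le_div_iff₀ hr]
        rw [le_div_iff₀ hR1] at hrle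
        nlinarith [le_abs_self R]
      calc θ ‖r⁻¹ • (y - x)‖ ≤ τ * ‖r⁻¹ • (y - x)‖ ^ (-α) := hR _ hRz
        _ ≤ τ * (s₀ / r) ^ (-α) := by
          gcongr ?_ * ?_
          exact Real.rpow_le_rpow_of_nonpos (by positivity) hz (by linarith)
        _ = τ * s₀ ^ (-α) * r ^ α := by
          rw [Real.div_rpow hs₀.le hr.le, Real.rpow_neg hr.le, div_inv_eq_mul, mul_assoc]
    have key := measureReal_closedBall_le_of_smoothing hθ hθ0 hψ hK hθψ hψθ (ρ := 23 / 8) hr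
      (hA x (huA _ hB).1) hτ (by positivity)
    rw [← hsm (x, r)] at key
    have hD := abs_nonneg (smoothedValue μ ψ (x, r))
    have hE : 0 ≤ τ * s₀ ^ (-α) * r ^ α := by positivity
    change p (closedBall x (23 / 8 * r)) ≤ ENNReal.ofReal C₁ *
      (ENNReal.ofReal |smoothedValue μ ψ (x, r)| +
        ENNReal.ofReal (τ * s₀ ^ (-α)) * ENNReal.ofReal (r ^ α))
    rw [← ENNReal.ofReal_mul (by positivity), ← ENNReal.ofReal_add hD hE,
      ← ENNReal.ofReal_mul hC₁0, ← ofReal_measureReal]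
    refine ENNReal.ofReal_le_ofReal ?_
    rw [hC₁, div_mul_eq_mul_div _ _ (_ + _), le_div_iff₀ hθpos]
    have h1 : 0 ≤ 2 * K * (τ * s₀ ^ (-α) * r ^ α) := by positivity
    have h2 : 0 ≤ 2 * K ^ 2 * N * |smoothedValue μ ψ (x, r)| := by positivity
    linarith
  have hcount : u.Countable := hu.2.countable_of_isOpen (fun B _ => isOpen_ball)
    fun B hB => nonempty_ball.2 (hu.1 B hB)
  set S := ∑' B : u, ENNReal.ofReal (B.1.2 ^ α)
  have hSg : g S.toNNReal ≤ g T := hg (by simpa using ENNReal.toNNReal_mono ENNReal.coe_ne_top huT)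
  have hτ' : ENNReal.ofReal (τ * s₀ ^ (-α)) = ((τ * (s₀ ^ (-α)).toNNReal : ℝ≥0) : ℝ≥0∞) := by
    rw [ENNReal.ofReal_mul τ.coe_nonneg, ENNReal.ofReal_coe_nnreal, ENNReal.coe_mul]; rfl
  calc p A ≤ p (⋃ B ∈ u, closedBall B.1 (23 / 8 * B.2)) := measure_mono hAu
    _ ≤ ∑' B : u, p (closedBall B.1.1 (23 / 8 * B.1.2)) := measure_biUnion_le _ hcount _
    _ ≤ ∑' B : u, ENNReal.ofReal C₁ * (ENNReal.ofReal |smoothedValue μ ψ B.1| +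
        ENNReal.ofReal (τ * s₀ ^ (-α)) * ENNReal.ofReal (B.1.2 ^ α)) :=
      ENNReal.tsum_le_tsum hball
    _ = ENNReal.ofReal C₁ * (∑' B : u, ENNReal.ofReal |smoothedValue μ ψ B.1| +
        ENNReal.ofReal (τ * s₀ ^ (-α)) * S) := by
      rw [ENNReal.tsum_mul_left, ENNReal.tsum_add, ENNReal.tsum_mul_left]
    _ ≤ ENNReal.ofReal C₁ * (((Cμ * g S.toNNReal : ℝ≥0) : ℝ≥0∞) +
        ENNReal.ofReal (τ * s₀ ^ (-α)) * T) := by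
      gcongr
      exact hCμ u hu (huT.trans_lt ENNReal.coe_lt_top).ne
    _ = ((C₁.toNNReal * (Cμ * g S.toNNReal + τ * (s₀ ^ (-α)).toNNReal * T) : ℝ≥0) : ℝ≥0∞) := by
      rw [hτ']; push_cast; rfl
    _ ≤ _ := by
      rw [ENNReal.coe_le_coe, mul_assoc C₁.toNNReal (Cμ + 1)]
      refine mul_le_mul_right ?_ _
      calc Cμ * g S.toNNReal + τ * (s₀ ^ (-α)).toNNReal * T
          ≤ (Cμ + 1) * g T + (Cμ + 1) * (τ * (s₀ ^ (-α)).toNNReal * T) := by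
            gcongr ?_ * ?_ + ?_
            · exact le_self_add
            · exact le_mul_of_one_le_left (by positivity) le_add_self
        _ = _ := by ring

/-- A bound for the intersections of `A` with the sets on which `n` is uniformly small compared
with `p` is a bound for `p A`, if `p` and `n` are mutually singular. -/
theorem measure_le_of_forall_inter_le (hpn : p ⟂ₘ n) {ε : ℝ≥0∞} (hε : ε ≠ 0) (hε' : ε ≠ ∞)
    (A : Set (EuclideanSpace ℝ (Fin d))) {b : ℝ≥0∞}
    (h : ∀ A' ⊆ A, ∀ s₀ : ℝ, 0 < s₀ →
      (∀ x ∈ A', ∀ s, 0 ≤ s → s ≤ s₀ → n (closedBall x s) ≤ ε * p (closedBall x s)) → p A' ≤ b) :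
    p A ≤ b := by
  let G : ℕ → Set (EuclideanSpace ℝ (Fin d)) := fun k => {x | ∀ s, 0 ≤ s →
    s ≤ 1 / ((k : ℝ) + 1) → n (closedBall x s) ≤ ε * p (closedBall x s)}
  have hmono : Monotone fun k => A ∩ G k := by
    intro k l hkl
    refine inter_subset_inter_right _ fun x hx s hs0 hs => hx s hs0 (hs.trans ?_)
    gcongr
  calc p A ≤ p (⋃ k, A ∩ G k) := by
        refine measure_mono_ae ?_
        filter_upwards [ae_exists_measure_closedBall_le p n hpn hε hε'] with x ⟨k, hk⟩ hxA
        exact mem_iUnion.2 ⟨k, hxA, hk⟩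
    -- Continuity along increasing unions needs no measurability of `A` or `G k`.
    _ = ⨆ k, p (A ∩ G k) := hmono.measure_iUnion
    _ ≤ b := iSup_le fun k => h _ inter_subset_left _ (by positivity) fun x hx => hx.2

/-- The estimates for one of the parts of the Jordan decomposition. -/
theorem DisjointBallEstimate.measure_le_of_mutuallySingular (hα : 0 ≤ α) (hθ : Antitone θ)
    (hθ0 : ∀ t, 0 ≤ θ t)
    (hθpos : 0 < θ (23 / 8)) (hψ : Measurable ψ) (hK : 0 < K)
    (hθψ : ∀ x, θ ‖x‖ ≤ K * ψ x) (hψθ : ∀ x, ψ x ≤ K * θ ‖x‖)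
    (hsm : ∀ B, |smoothedValue μ ψ B| =
      |∫ y, ψ (B.2⁻¹ • (y - B.1)) ∂p - ∫ y, ψ (B.2⁻¹ • (y - B.1)) ∂n|)
    (hpn : p ⟂ₘ n)
    (hg : IsRegularFunction g) (hμ : DisjointBallEstimate μ ψ g α) :
    ((∃ τ : ℝ≥0, ∃ R : ℝ, ∀ z : EuclideanSpace ℝ (Fin d), R ≤ ‖z‖ → θ ‖z‖ ≤ τ * ‖z‖ ^ (-α)) →
      p ≪ Measure.hausdorffMeasure α) ∧
    ((∀ τ : ℝ≥0, 0 < τ →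
      ∃ R : ℝ, ∀ z : EuclideanSpace ℝ (Fin d), R ≤ ‖z‖ → θ ‖z‖ ≤ τ * ‖z‖ ^ (-α)) →
      ∃ C : ℝ≥0, ∀ A : Set (EuclideanSpace ℝ (Fin d)), Measure.hausdorffMeasure α A ≠ ∞ →
        p A ≤ ((C * g (Measure.hausdorffMeasure α A).toNNReal : ℝ≥0) : ℝ≥0∞)) := by
  have hε : ENNReal.ofReal (1 / (2 * K ^ 2)) ≠ 0 := by
    rw [Ne, ENNReal.ofReal_eq_zero, not_le]; positivity
  obtain ⟨C, hC⟩ := hμ.exists_measure_le hα hθ hθ0 hθpos hψ hK hθψ hψθ hsm hg.monotone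
  have hgc := hg.continuous
  refine ⟨fun ⟨τ, hτ⟩ A hA => ?_, fun hτ => ?_⟩
  · refine le_antisymm (measure_le_of_forall_inter_le hpn hε ENNReal.ofReal_ne_top A
      fun A' hA' s₀ hs₀ h => ?_) (zero_le)
    have hcont : Continuous fun T : ℝ≥0 =>
        ((C * (g T + τ * (s₀ ^ (-α)).toNNReal * T) : ℝ≥0) : ℝ≥0∞) :=
      ENNReal.continuous_coe.comp (by fun_prop)
    have hlim := (hcont.tendsto 0).mono_left (nhdsWithin_le_nhds (s := Ioi 0))
    simp only [hg.map_zero, mul_zero, add_zero, ENNReal.coe_zero] at hlim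
    refine ge_of_tendsto hlim ?_
    filter_upwards [self_mem_nhdsWithin] with T hT
    refine hC A' s₀ hs₀ h τ hτ T ?_
    rw [measure_mono_null hA' hA, mul_zero]
    exact_mod_cast hT
  · obtain ⟨C', hC'⟩ := hg.exists_map_mul_le (4 ^ α : ℝ).toNNReal
    refine ⟨C * C', fun A hA => measure_le_of_forall_inter_le hpn hε ENNReal.ofReal_ne_top A
      fun A' hA' s₀ hs₀ h => ?_⟩
    set H := (Measure.hausdorffMeasure α A).toNNReal with hH
    have hstep : ∀ T : ℝ≥0, (4 ^ α : ℝ).toNNReal * H < T → p A' ≤ ((C * g T : ℝ≥0) : ℝ≥0∞) := by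
      intro T hT
      have hcont : Continuous fun τ : ℝ≥0 =>
          ((C * (g T + τ * (s₀ ^ (-α)).toNNReal * T) : ℝ≥0) : ℝ≥0∞) :=
        ENNReal.continuous_coe.comp (by fun_prop)
      -- Here `τ → 0` with `s₀` and `T` fixed, which removes the dependence on `s₀`.
      have hlim := (hcont.tendsto 0).mono_left (nhdsWithin_le_nhds (s := Ioi 0))
      simp only [zero_mul, add_zero] at hlim
      refine ge_of_tendsto hlim ?_
      filter_upwards [self_mem_nhdsWithin] with τ hτ0
      refine hC A' s₀ hs₀ h τ (hτ τ hτ0) T ?_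
      calc ENNReal.ofReal (4 ^ α) * Measure.hausdorffMeasure α A'
          ≤ ENNReal.ofReal (4 ^ α) * Measure.hausdorffMeasure α A := by gcongr
        _ = (((4 ^ α : ℝ).toNNReal * H : ℝ≥0) : ℝ≥0∞) := by
          rw [ENNReal.coe_mul, hH, ENNReal.coe_toNNReal hA]; rfl
        _ < T := ENNReal.coe_lt_coe.2 hT
    have hcont : Continuous fun T : ℝ≥0 => ((C * g T : ℝ≥0) : ℝ≥0∞) :=
      ENNReal.continuous_coe.comp (by fun_prop)
    have hle : p A' ≤ ((C * g ((4 ^ α : ℝ).toNNReal * H) : ℝ≥0) : ℝ≥0∞) := by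
      refine ge_of_tendsto ((hcont.tendsto _).mono_left (nhdsWithin_le_nhds (s := Ioi ((4 ^ α : ℝ).toNNReal * H)))) ?_
      filter_upwards [self_mem_nhdsWithin] with T hT using hstep T hT
    refine hle.trans (ENNReal.coe_le_coe.2 ?_)
    rw [mul_assoc]
    gcongr
    exact hC' H

end

/-! ### Sign, decay and positivity of the kernel -/

/-- A nonnegative radially non-increasing function has a nonnegative non-increasing profile. -/
theorem RadiallyNonincreasing.exists_antitone {d : ℕ} {φ : EuclideanSpace ℝ (Fin d) → ℝ}
    (hφ : RadiallyNonincreasing φ) (hφ0 : ∀ x, 0 ≤ φ x) :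
    ∃ θ : ℝ → ℝ, Antitone θ ∧ (∀ t, 0 ≤ θ t) ∧ ∀ x, φ x = θ ‖x‖ := by
  obtain ⟨θ, hθ, hφθ⟩ := hφ
  refine ⟨fun t => max (θ (max t 0)) 0, fun s t hst => ?_, fun t => le_max_right _ _, fun x => ?_⟩
  · exact max_le_max_right _ (hθ (mem_Ici.2 (le_max_right _ _)) (mem_Ici.2 (le_max_right _ _))
      (max_le_max_right _ hst))
  · dsimp only
    rw [max_eq_left (norm_nonneg x), ← hφθ, max_eq_left (hφ0 x)]

/-- A non-increasing profile stays above its limit at infinity. Equivalence with `ψ` does not give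
the sign: `φ = ψ` may be negative. -/
theorem RadiallyNonincreasing.nonneg_of_tendsto_zero {d : ℕ} (hd : 1 ≤ d)
    {φ : EuclideanSpace ℝ (Fin d) → ℝ} (hφ : RadiallyNonincreasing φ)
    (h : Tendsto φ (Bornology.cobounded _) (𝓝 0)) (x : EuclideanSpace ℝ (Fin d)) : 0 ≤ φ x := by
  have : Nonempty (Fin d) := ⟨⟨0, hd⟩⟩
  obtain ⟨θ, hθ, hφθ⟩ := hφ
  refine le_of_tendsto h ?_
  filter_upwards [tendsto_norm_cobounded_atTop.eventually_ge_atTop ‖x‖] with y hy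
  rw [hφθ, hφθ]
  exact hθ (norm_nonneg _) (norm_nonneg _) hy

theorem isBigO_norm_rpow_neg_one {E : Type*} [NormedAddCommGroup E] {α : ℝ} (hα : 0 ≤ α) :
    (fun x : E => ‖x‖ ^ (-α)) =O[Bornology.cobounded E] fun _ => (1 : ℝ) := by
  refine IsBigO.of_bound 1 ?_
  filter_upwards [tendsto_norm_cobounded_atTop.eventually_ge_atTop 1] with x hx
  rw [Real.norm_of_nonneg (by positivity), norm_one, mul_one]
  exact Real.rpow_le_one_of_one_le_of_nonpos hx (by linarith)

theorem exists_le_mul_norm_rpow_of_isBigOWith {E : Type*} [NormedAddCommGroup E] {α c : ℝ}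
    {φ : E → ℝ}
    (h : IsBigOWith c (Bornology.cobounded E) φ fun x => ‖x‖ ^ (-α)) :
    ∃ R : ℝ, ∀ z : E, R ≤ ‖z‖ → φ z ≤ c * ‖z‖ ^ (-α) := by
  obtain ⟨R, -, hR⟩ := hasBasis_cobounded_norm.eventually_iff.1 h.bound
  refine ⟨R, fun z hz => (le_abs_self _).trans ?_⟩
  have := hR hz
  rwa [Real.norm_of_nonneg (by positivity : 0 ≤ ‖z‖ ^ (-α))] at this

/-- The profile of a nonnegative radially non-increasing function is positive in the interior of
the support. -/
theorem profile_pos_of_ball_subset_tsupport {d : ℕ} (hd : 1 ≤ d)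
    {φ : EuclideanSpace ℝ (Fin d) → ℝ} {θ : ℝ → ℝ} (hθ : Antitone θ) (hθ0 : ∀ t, 0 ≤ θ t)
    (hφθ : ∀ x, φ x = θ ‖x‖) {R t : ℝ} (hφ : ball 0 R ⊆ tsupport φ) (ht0 : 0 ≤ t) (ht : t < R) :
    0 < θ t := by
  have : Nonempty (Fin d) := ⟨⟨0, hd⟩⟩
  refine (hθ0 t).lt_of_ne fun h0 => ?_
  have hsub : tsupport φ ⊆ closedBall 0 t := by
    refine closure_minimal (fun x hx => ?_) isClosed_closedBall
    rw [mem_closedBall_zero_iff]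
    by_contra! hlt
    exact hx (by rw [hφθ]; exact le_antisymm (h0 ▸ hθ hlt.le) (hθ0 _))
  obtain ⟨x, hx⟩ := exists_norm_eq (EuclideanSpace ℝ (Fin d)) (c := (t + R) / 2) (by linarith)
  have := hsub (hφ (show x ∈ ball 0 R by rw [mem_ball_zero_iff, hx]; linarith))
  rw [mem_closedBall_zero_iff, hx] at this
  linarith

/-! ### Assembly of the two Jordan parts -/

/-- Both conclusions for a kernel that is nonnegative. -/
theorem DisjointBallEstimate.totalVariation_le {d : ℕ} (hd : 1 ≤ d) {α : ℝ} (hα : 0 ≤ α)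
    {φ ψ : EuclideanSpace ℝ (Fin d) → ℝ} (hφ0 : ∀ x, 0 ≤ φ x)
    (hφ_rad : RadiallyNonincreasing φ) (hφ_supp : Metric.ball 0 3 ⊆ tsupport φ)
    (hψ : Measurable ψ) (hφψ : EquivalentFunctions φ ψ)
    {μ : SignedMeasure (EuclideanSpace ℝ (Fin d))} {g : ℝ≥0 → ℝ≥0} (hg : IsRegularFunction g)
    (hμ : DisjointBallEstimate μ ψ g α) :
    (φ =O[Bornology.cobounded (EuclideanSpace ℝ (Fin d))] (fun x => ‖x‖ ^ (-α)) →
      μ.totalVariation ≪ Measure.hausdorffMeasure α) ∧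
    (φ =o[Bornology.cobounded (EuclideanSpace ℝ (Fin d))] (fun x => ‖x‖ ^ (-α)) →
      ∃ C : ℝ≥0, ∀ A : Set (EuclideanSpace ℝ (Fin d)), Measure.hausdorffMeasure α A ≠ ∞ →
        μ.totalVariation A ≤
          ((C * g (Measure.hausdorffMeasure α A).toNNReal : ℝ≥0) : ℝ≥0∞)) := by
  obtain ⟨θ, hθ, hθ0, hφθ⟩ := hφ_rad.exists_antitone hφ0
  obtain ⟨K, hK, hφψ⟩ := hφψ
  have hθψ : ∀ x, θ ‖x‖ ≤ K * ψ x := fun x => by rw [← hφθ]; exact (hφψ x).1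
  have hψθ : ∀ x, ψ x ≤ K * θ ‖x‖ := fun x => by rw [← hφθ]; exact (hφψ x).2
  have hθpos : 0 < θ (23 / 8) :=
    profile_pos_of_ball_subset_tsupport hd hθ hθ0 hφθ hφ_supp (by norm_num) (by norm_num)
  have hψM : ∀ x, |ψ x| ≤ K * θ 0 := fun x => by
    rw [abs_of_nonneg (nonneg_of_mul_nonneg_right ((hθ0 _).trans (hθψ x)) hK)]
    exact (hψθ x).trans (mul_le_mul_of_nonneg_left (hθ (norm_nonneg x)) hK.le)
  have hsm := fun B => congrArg abs (smoothedValue_eq_sub μ hψ hψM B)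
  have hsing := μ.toJordanDecomposition.mutuallySingular
  obtain ⟨hpO, hpo⟩ := hμ.measure_le_of_mutuallySingular hα hθ hθ0 hθpos hψ hK hθψ hψθ hsm hsing hg
  obtain ⟨hnO, hno⟩ := hμ.measure_le_of_mutuallySingular hα hθ hθ0 hθpos hψ hK hθψ hψθ
    (fun B => (hsm B).trans (abs_sub_comm _ _)) hsing.symm hg
  refine ⟨fun hO => ?_, fun ho => ?_⟩
  · obtain ⟨c, hc, hO⟩ := hO.exists_pos
    lift c to ℝ≥0 using hc.le
    have hτ : ∃ τ : ℝ≥0, ∃ R : ℝ, ∀ z : EuclideanSpace ℝ (Fin d),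
        R ≤ ‖z‖ → θ ‖z‖ ≤ τ * ‖z‖ ^ (-α) :=
      ⟨c, by simpa only [← hφθ] using exists_le_mul_norm_rpow_of_isBigOWith hO⟩
    exact Measure.AbsolutelyContinuous.add_left (hpO hτ) (hnO hτ)
  · have hτ : ∀ τ : ℝ≥0, 0 < τ → ∃ R : ℝ, ∀ z : EuclideanSpace ℝ (Fin d),
        R ≤ ‖z‖ → θ ‖z‖ ≤ τ * ‖z‖ ^ (-α) := fun τ hτ => by
      simpa only [← hφθ] using
        exists_le_mul_norm_rpow_of_isBigOWith (ho.forall_isBigOWith (NNReal.coe_pos.2 hτ))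
    obtain ⟨C₁, hC₁⟩ := hpo hτ
    obtain ⟨C₂, hC₂⟩ := hno hτ
    refine ⟨C₁ + C₂, fun A hA => ?_⟩
    rw [SignedMeasure.totalVariation, Measure.add_apply, add_mul, ENNReal.coe_add]
    exact add_le_add (hC₁ A hA) (hC₂ A hA)

theorem mainTheorem4 (d : ℕ) (hd : 1 ≤ d) (α : ℝ) (hα : 0 ≤ α)
    (φ ψ : EuclideanSpace ℝ (Fin d) → ℝ)
    (hφ_bdd : ∃ M : ℝ, ∀ x, |φ x| ≤ M)
    (hφ_rad : RadiallyNonincreasing φ)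
    (hφ_supp : Metric.ball 0 3 ⊆ tsupport φ)
    (hψ_meas : Measurable ψ)
    (hφψ : EquivalentFunctions φ ψ)
    (μ : SignedMeasure (EuclideanSpace ℝ (Fin d)))
    (g : ℝ≥0 → ℝ≥0) (hg : IsRegularFunction g)
    (hμ : DisjointBallEstimate μ ψ g α) :
    (φ =O[Bornology.cobounded (EuclideanSpace ℝ (Fin d))] (fun x => ‖x‖ ^ (-α)) →
      μ.totalVariation ≪
        (Measure.hausdorffMeasure α : Measure (EuclideanSpace ℝ (Fin d)))) ∧
    (φ =o[Bornology.cobounded (EuclideanSpace ℝ (Fin d))] (fun x => ‖x‖ ^ (-α)) →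
      ∃ C : ℝ≥0, ∀ A : Set (EuclideanSpace ℝ (Fin d)), MeasurableSet A →
        Measure.hausdorffMeasure α A ≠ ∞ →
        μ.totalVariation A ≤ ((C * g (Measure.hausdorffMeasure α A).toNNReal : ℝ≥0) : ℝ≥0∞)) := by
  have main := fun h0 : ∀ x, 0 ≤ φ x => hμ.totalVariation_le hd hα h0 hφ_rad hφ_supp hψ_meas hφψ hg
  refine ⟨fun hO => ?_, fun ho => ?_⟩
  -- For `α = 0` a bounded kernel need not decay, so its sign is unknown; but only the empty set is
  -- null for counting measure.
  · rcases hα.eq_or_lt with rfl | hα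
    · intro A hA
      have hempty : A = ∅ := eq_empty_of_forall_notMem fun x hx => by
        have := measure_mono_null (singleton_subset_iff.2 hx) hA
        rw [Measure.hausdorffMeasure_zero_singleton] at this
        exact one_ne_zero this
      rw [hempty, measure_empty]
    · exact (main (hφ_rad.nonneg_of_tendsto_zero hd (hO.trans_tendsto
        ((tendsto_rpow_neg_atTop hα).comp tendsto_norm_cobounded_atTop)))).1 hO
  · obtain ⟨C, hC⟩ := (main (hφ_rad.nonneg_of_tendsto_zero hd ((isLittleO_one_iff ℝ).1
      (ho.trans_isBigO (isBigO_norm_rpow_neg_one hα))))).2 ho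
    exact ⟨C, fun A _ hA => hC A hA⟩
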